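/- Let $m,q\ge 0$ be integers, let $Y_1,Y_2,\dots$ be i.i.d. random points of $(\mathbb{R}P^m)^q$ with distribution $Q$, and write $Y_r=([X_{r,1}],\dots,[X_{r,q}])$ with $X_{r,s}\in\mathbb{R}^{m+1}$, $\|X_{r,s}\|=1$. For $s=1,\dots,q$ let $\lambda_s(1)\le\dots\le\lambda_s(m+1)$ be the eigenvalues of $E[X_{1,s}X_{1,s}^T]$ and $\gamma_s(1),\dots,\gamma_s(m+1)$ corresponding orthonormal eigenvectors; put $\gamma_s=\gamma_s(m+1)$. For each sample size $n$ let $d_s(1)\le\dots\le d_s(m+1)$ be the eigenvalues of $J_s=\frac1n\sum_{r=1}^nX_{r,s}X_{r,s}^T$ and $g_s(1),\dots,g_s(m+1)$ any measurable choice of corresponding orthonormal eigenvectors, the signs of the top ones being chosen consistently with the $\gamma_s$, that is, $(\gamma_s^Tg_s(m+1))\,(\gamma_t^Tg_t(m+1))\ge 0$ for all $s,t$ (no condition if $q=1$). Let $D_s=(g_s(1),\dots,g_s(m))$, let $v=(\gamma_1^TD_1,\dots,\gamma_q^TD_q)$, a row vector of length $M=mq$, and let $G$ be the $M\times M$ matrix,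 indexed by the pairs $(s,a)$, $1\le s\le q$, $1\le a\le m$, in lexicographic order, $$G_{(s,a),(t,b)}=\frac{\sum_{r=1}^n (g_s(a)^TX_{r,s})(g_t(b)^TX_{r,t})(g_s(m+1)^TX_{r,s})(g_t(m+1)^TX_{r,t})}{n\,(d_s(m+1)-d_s(a))\,(d_t(m+1)-d_t(b))}.$$ Suppose that, for every $s$, the largest eigenvalue $\lambda_s(m+1)$ is positive and simple, and that the covariance matrix of the $M$ random variables $(\gamma_s(a)^TX_{1,s})(\gamma_s^TX_{1,s})$, $1\le s\le q$, $1\le a\le m$ (the covariance of $(X_{1,s}X_{1,s}^T)_{s}$ restricted to the tangent space of the embedded $(\mathbb{R}P^m)^q$ at $(\gamma_s\gamma_s^T)_s$, up to the factor $2$) is nonsingular. Then $$T^2(Y;Q)=n\,v\,G^{-1}v^T$$ converges weakly, as $n\to\infty$, to $\chi^2_M$, the distribution of the sum of the squares of $M$ independent standard normal variables. (Where $d_s(m+1)$ is not simple or $G$ is singular, events whose probability tends to $0$, a reciprocal of $0$ is read as $0$ and the inverse of a singular matrix as $0$.) -/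

import Mathlib

open MeasureTheory ProbabilityTheory Filter Topology
open scoped LinearAlgebra.Projectivization

noncomputable section

namespace AxialMean

/-- The Euclidean space of column vectors with `m + 1` entries. -/
abbrev Vec (m : ℕ) := EuclideanSpace ℝ (Fin (m + 1))

/-- Real projective space of dimension `m`: the lines through the origin of `Vec m`. -/
abbrev RP (m : ℕ) := ℙ ℝ (Vec m)

/-- The quotient topology from the nonzero vectors. -/
instance instTopologicalSpaceRP (m : ℕ) : TopologicalSpace (RP m) :=
  inferInstanceAs (TopologicalSpace (Quotient (projectivizationSetoid ℝ (Vec m))))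

/-- The Borel sets. Products such as `Fin q → RP m` carry the product of these. -/
instance instMeasurableSpaceRP (m : ℕ) : MeasurableSpace (RP m) := borel (RP m)

instance instBorelSpaceRP (m : ℕ) : BorelSpace (RP m) := ⟨rfl⟩

/-- `x` is a unit vector representing the projective point `p`, that is `p = [x]`, `‖x‖ = 1`. -/
def IsUnitRep {m : ℕ} (x : Vec m) (p : RP m) : Prop :=
  ‖x‖ = 1 ∧ ∃ hx : x ≠ 0, Projectivization.mk ℝ x hx = p

/-- The matrix `E[Z Zᵀ]` of a random vector `Z`, entry by entry. -/
def momentMatrix {Ω : Type*} [MeasurableSpace Ω] {m : ℕ} (P : Measure Ω) (Z : Ω → Vec m) :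
    Matrix (Fin (m + 1)) (Fin (m + 1)) ℝ :=
  Matrix.of fun i j => ∫ ω, Z ω i * Z ω j ∂P

/-- `J = n⁻¹ ∑_{r < n} x_r x_rᵀ`. -/
def sampleMomentMatrix {m : ℕ} (n : ℕ) (x : ℕ → Vec m) :
    Matrix (Fin (m + 1)) (Fin (m + 1)) ℝ :=
  (n : ℝ)⁻¹ • ∑ r ∈ Finset.range n, Matrix.vecMulVec (x r).ofLp (x r).ofLp

/-- `d 0 ≤ ⋯ ≤ d m` are the eigenvalues of `A` in increasing order, with multiplicity, and
`g 0, …, g m` are corresponding orthonormal eigenvectors. -/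
structure IsOrderedEigensystem {m : ℕ} (A : Matrix (Fin (m + 1)) (Fin (m + 1)) ℝ)
    (d : Fin (m + 1) → ℝ) (g : Fin (m + 1) → Vec m) : Prop where
  monotone : Monotone d
  orthonormal : Orthonormal ℝ g
  eigen : ∀ a, A.mulVec (g a).ofLp = d a • (g a).ofLp

/-- The studentizing matrix `G`, with rows and columns indexed by the pairs `(s, a)`, `s < q`,
`a < m`, for the sample `x 0, …, x (n - 1)` and eigenvalues `d s`, eigenvectors `g s`
(the index `Fin.last m` is that of the largest eigenvalue). -/
def studentMatrix {m q : ℕ} (n : ℕ) (x : ℕ → Fin q → Vec m)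
    (d : Fin q → Fin (m + 1) → ℝ) (g : Fin q → Fin (m + 1) → Vec m) :
    Matrix (Fin q × Fin m) (Fin q × Fin m) ℝ :=
  Matrix.of fun i j =>
    (n : ℝ)⁻¹ * (d i.1 (Fin.last m) - d i.1 i.2.castSucc)⁻¹
      * (d j.1 (Fin.last m) - d j.1 j.2.castSucc)⁻¹
      * ∑ r ∈ Finset.range n,
          inner ℝ (g i.1 i.2.castSucc) (x r i.1) * inner ℝ (g j.1 j.2.castSucc) (x r j.1)
            * inner ℝ (g i.1 (Fin.last m)) (x r i.1) * inner ℝ (g j.1 (Fin.last m)) (x r j.1)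

/-- The row vector `(γ₁ᵀ D₁, …, γ_qᵀ D_q)`, where `D_s` has the columns `g s 0, …, g s (m - 1)`. -/
def tangentCoords {m q : ℕ} (γ : Fin q → Vec m) (g : Fin q → Fin (m + 1) → Vec m) :
    Fin q × Fin m → ℝ :=
  fun i => inner ℝ (γ i.1) (g i.1 i.2.castSucc)

/-- The statistic `T² = n v G⁻¹ vᵀ`, `v` the row vector `tangentCoords γ g`. -/
def hotellingT2 {m q : ℕ} (n : ℕ) (x : ℕ → Fin q → Vec m) (γ : Fin q → Vec m)
    (d : Fin q → Fin (m + 1) → ℝ) (g : Fin q → Fin (m + 1) → Vec m) : ℝ :=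
  (n : ℝ) * (tangentCoords γ g ⬝ᵥ ((studentMatrix n x d g)⁻¹).mulVec (tangentCoords γ g))

/-- The covariance matrix of the tangential coordinates
`(γ_s(a) ⬝ Z_s) (γ_s(m+1) ⬝ Z_s)`, `s < q`, `a < m`, of the random point `(Z_s Z_sᵀ)_s`.
They are its coordinates (up to a factor `√2`) along the orthogonal vectors
`γ_s(a) γ_s(m+1)ᵀ + γ_s(m+1) γ_s(a)ᵀ`, which span the tangent space of the embedded `(RP m)^q` at
`(γ_s(m+1) γ_s(m+1)ᵀ)_s`. -/
def tangentCovariance {Ω : Type*} [MeasurableSpace Ω] {m q : ℕ} (P : Measure Ω)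
    (Z : Ω → Fin q → Vec m) (γ : Fin q → Fin (m + 1) → Vec m) :
    Matrix (Fin q × Fin m) (Fin q × Fin m) ℝ :=
  Matrix.of fun i j =>
    cov[fun ω => inner ℝ (γ i.1 i.2.castSucc) (Z ω i.1) * inner ℝ (γ i.1 (Fin.last m)) (Z ω i.1),
      fun ω => inner ℝ (γ j.1 j.2.castSucc) (Z ω j.1) * inner ℝ (γ j.1 (Fin.last m)) (Z ω j.1); P]

/-- The chi-square distribution with `k` degrees of freedom: the law of the sum of the squares of
`k` independent standard normal variables (the unit mass at `0` if `k = 0`). -/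
def chiSquare (k : ℕ) : Measure ℝ :=
  (Measure.pi fun _ : Fin k => gaussianReal 0 1).map fun z => ∑ i, z i ^ 2

instance instIsProbabilityMeasureChiSquare (k : ℕ) : IsProbabilityMeasure (chiSquare k) :=
  Measure.isProbabilityMeasure_map (by
    have h : Measurable fun z : Fin k → ℝ => ∑ i, z i ^ 2 := by fun_prop
    exact h.aemeasurable)

end AxialMean

end

/-! The vector `v` and the matrix `G` live in the sample frame, whose lower eigenvectors need not
converge, since the lower population eigenvalues may coincide. The matrix `T = alignMatrix` carries
both to the population frame. Because `J_s` is diagonal in its own frame, `T v` equals minus the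
sample mean of `tangentScore` exactly, with no linearization (`alignMatrix_mulVec_tangentCoords`).
The same `T` cancels the reciprocal gaps in `G`: the matrix `T G Tᵀ` is an average of outer products
of projected scores, which see the sample frame only through its top vectors
(`alignMatrix_mul_studentMatrix_mul`). Those converge up to sign by a Rayleigh quotient argument
(`tendsto_inner_top_sq`), with one sign for all factors, so `T G Tᵀ` tends almost surely to the
covariance `C` of the scores.

The quadratic form is invariant under `T`, and under a further whitening `B` with `B C Bᵀ = 1`
(`dotProduct_inv_mulVec_congr`). The scores are i.i.d., bounded, and centered because the frame
diagonalizes the moment matrices. Hence the whitened normalized sums are asymptotically standard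
normal, and Slutsky's theorem (`tendstoInDistribution_chiSquare`) replaces the random matrix by the
identity, leaving the squared norm of a standard normal vector. -/

noncomputable section

namespace AxialMean

/-! ### Spectral expansions and perturbation of the top eigenvector. -/

namespace IsOrderedEigensystem

variable {m : ℕ} {A : Matrix (Fin (m + 1)) (Fin (m + 1)) ℝ} {d : Fin (m + 1) → ℝ}
  {g : Fin (m + 1) → Vec m}

/-- The eigenvectors form an orthonormal basis. -/
theorem exists_orthonormalBasis (h : IsOrderedEigensystem A d g) :
    ∃ b : OrthonormalBasis (Fin (m + 1)) ℝ (Vec m), ∀ a, b a = g a := by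
  obtain ⟨b, hb⟩ := Orthonormal.exists_orthonormalBasis_extension_of_card_eq (𝕜 := ℝ)
    (ι := Fin (m + 1)) (E := Vec m) (by simp) (v := g) (s := Set.univ)
    (h.orthonormal.comp _ Subtype.val_injective)
  exact ⟨b, fun a => hb a (Set.mem_univ a)⟩

theorem sum_inner_mul_inner (h : IsOrderedEigensystem A d g) (x y : Vec m) :
    ∑ a, inner ℝ x (g a) * inner ℝ (g a) y = inner ℝ x y := by
  obtain ⟨b, hb⟩ := h.exists_orthonormalBasis
  simpa [hb] using b.sum_inner_mul_inner x y

theorem sum_inner_sq (h : IsOrderedEigensystem A d g) (x : Vec m) :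
    ∑ a, inner ℝ (g a) x ^ 2 = ‖x‖ ^ 2 := by
  rw [← real_inner_self_eq_norm_sq, ← h.sum_inner_mul_inner]
  exact Finset.sum_congr rfl fun a _ => by rw [real_inner_comm x (g a), sq]

/-- The spectral expansion of the bilinear form of `A`. -/
theorem dotProduct_mulVec (h : IsOrderedEigensystem A d g) (x y : Vec m) :
    x.ofLp ⬝ᵥ A.mulVec y.ofLp = ∑ a, d a * (inner ℝ x (g a) * inner ℝ (g a) y) := by
  obtain ⟨b, hb⟩ := h.exists_orthonormalBasis
  have hy : y.ofLp = ∑ a, inner ℝ (g a) y • (g a).ofLp := by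
    conv_lhs => rw [← b.sum_repr' y]
    simp [hb]
  have hx : ∀ a, x.ofLp ⬝ᵥ (g a).ofLp = inner ℝ x (g a) := fun a => by
    simp [PiLp.inner_apply, dotProduct, mul_comm]
  conv_lhs => rw [hy]
  simp only [Matrix.mulVec_sum, Matrix.mulVec_smul, h.eigen, dotProduct_sum, dotProduct_smul, hx,
    smul_eq_mul]
  exact Finset.sum_congr rfl fun a _ => by ring

theorem dotProduct_mulVec_self (h : IsOrderedEigensystem A d g) (x : Vec m) :
    x.ofLp ⬝ᵥ A.mulVec x.ofLp = ∑ a, d a * inner ℝ (g a) x ^ 2 := by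
  rw [h.dotProduct_mulVec]
  exact Finset.sum_congr rfl fun a _ => by rw [real_inner_comm x (g a), sq]

theorem dotProduct_mulVec_eigenvector (h : IsOrderedEigensystem A d g) (a b : Fin (m + 1)) :
    (g a).ofLp ⬝ᵥ A.mulVec (g b).ofLp = if a = b then d a else 0 := by
  rw [h.dotProduct_mulVec]
  simp only [orthonormal_iff_ite.1 h.orthonormal]
  simp +contextual [eq_comm]

theorem dotProduct_mulVec_self_le (h : IsOrderedEigensystem A d g) {x : Vec m} (hx : ‖x‖ = 1) :
    x.ofLp ⬝ᵥ A.mulVec x.ofLp ≤ d (Fin.last m) := by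
  rw [h.dotProduct_mulVec_self]
  calc ∑ a, d a * inner ℝ (g a) x ^ 2 ≤ ∑ a, d (Fin.last m) * inner ℝ (g a) x ^ 2 :=
        Finset.sum_le_sum fun a _ =>
          mul_le_mul_of_nonneg_right (h.monotone (Fin.le_last a)) (sq_nonneg _)
    _ = d (Fin.last m) := by rw [← Finset.mul_sum, h.sum_inner_sq, hx]; ring

/-- A gap below the largest eigenvalue bounds the quadratic form away from the top eigenvector. -/
theorem dotProduct_mulVec_self_le_of_gap (h : IsOrderedEigensystem A d g) {δ : ℝ}
    (hδ : ∀ a, a ≠ Fin.last m → d a ≤ d (Fin.last m) - δ) {x : Vec m} (hx : ‖x‖ = 1) :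
    x.ofLp ⬝ᵥ A.mulVec x.ofLp ≤
      d (Fin.last m) - δ * (1 - inner ℝ (g (Fin.last m)) x ^ 2) := by
  have hs : ∑ a : Fin m, inner ℝ (g a.castSucc) x ^ 2 = 1 - inner ℝ (g (Fin.last m)) x ^ 2 := by
    have := h.sum_inner_sq x
    rw [Fin.sum_univ_castSucc, hx] at this
    linarith
  rw [h.dotProduct_mulVec_self, Fin.sum_univ_castSucc]
  have : ∑ a : Fin m, d a.castSucc * inner ℝ (g a.castSucc) x ^ 2 ≤
      ∑ a : Fin m, (d (Fin.last m) - δ) * inner ℝ (g a.castSucc) x ^ 2 :=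
    Finset.sum_le_sum fun a _ =>
      mul_le_mul_of_nonneg_right (hδ _ (Fin.castSucc_lt_last a).ne) (sq_nonneg _)
  rw [← Finset.mul_sum, hs] at this
  linarith

theorem norm_eq_one (h : IsOrderedEigensystem A d g) (a : Fin (m + 1)) : ‖g a‖ = 1 :=
  h.orthonormal.1 a

end IsOrderedEigensystem

theorem abs_dotProduct_mulVec_self_le {m : ℕ} (E : Matrix (Fin (m + 1)) (Fin (m + 1)) ℝ)
    {x : Vec m} (hx : ‖x‖ = 1) : |x.ofLp ⬝ᵥ E.mulVec x.ofLp| ≤ ∑ i, ∑ j, |E i j| := by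
  have hc : ∀ i, |x i| ≤ 1 := fun i => hx ▸ PiLp.norm_apply_le x i
  simp only [dotProduct, Matrix.mulVec, Finset.mul_sum]
  refine (Finset.abs_sum_le_sum_abs _ _).trans (Finset.sum_le_sum fun i _ =>
    (Finset.abs_sum_le_sum_abs _ _).trans (Finset.sum_le_sum fun j _ => ?_))
  rw [abs_mul, abs_mul]
  calc |x i| * (|E i j| * |x j|) ≤ 1 * (|E i j| * 1) := by gcongr <;> exact hc _
    _ = |E i j| := by ring

/-- An eigenvector for the largest eigenvalue of a perturbed matrix is almost parallel to the
top eigenvector of the unperturbed one. -/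
theorem gap_mul_one_sub_inner_sq_le {m : ℕ} {A B : Matrix (Fin (m + 1)) (Fin (m + 1)) ℝ}
    {lam d : Fin (m + 1) → ℝ} {gam g : Fin (m + 1) → Vec m}
    (hA : IsOrderedEigensystem A lam gam) (hB : IsOrderedEigensystem B d g) {δ : ℝ}
    (hδ : ∀ a, a ≠ Fin.last m → lam a ≤ lam (Fin.last m) - δ)
    {c : Fin (m + 1)} (hc : d c = d (Fin.last m)) :
    δ * (1 - inner ℝ (gam (Fin.last m)) (g c) ^ 2) ≤ 2 * ∑ i, ∑ j, |(B - A) i j| := by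
  -- The top eigenvalue of `B` is its value at `g c` and dominates its value at the top vector of
  -- `A`. Passing from `B` to `A` at these two vectors costs the entry sum once each, whence the
  -- factor 2.
  have h1 := hA.dotProduct_mulVec_self_le_of_gap hδ (hB.norm_eq_one c)
  have h2 := hB.dotProduct_mulVec_self_le (hA.norm_eq_one (Fin.last m))
  have h3 := hA.dotProduct_mulVec_eigenvector (Fin.last m) (Fin.last m)
  have h4 := hB.dotProduct_mulVec_eigenvector c c
  have h5 := abs_le.1 (abs_dotProduct_mulVec_self_le (B - A) (hA.norm_eq_one (Fin.last m)))
  have h6 := abs_le.1 (abs_dotProduct_mulVec_self_le (B - A) (hB.norm_eq_one c))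
  rw [if_pos rfl] at h3 h4
  rw [Matrix.sub_mulVec, dotProduct_sub] at h5 h6
  linarith [h5.1, h6.2]

theorem exists_eigenvalue_gap {m : ℕ} {lam : Fin (m + 1) → ℝ} (hmono : Monotone lam)
    (hsimple : ∀ a, lam a = lam (Fin.last m) → a = Fin.last m) :
    ∃ δ > 0, ∀ a, a ≠ Fin.last m → lam a ≤ lam (Fin.last m) - δ := by
  have hlt : ∀ a, a ≠ Fin.last m → lam a < lam (Fin.last m) := fun a ha =>
    lt_of_le_of_ne (hmono (Fin.le_last a)) fun h => ha (hsimple a h)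
  obtain ⟨δ, hδ, h⟩ : ∃ δ > 0, ∀ a ∈ Finset.univ.filter (· ≠ Fin.last m),
      δ ≤ lam (Fin.last m) - lam a := by
    rcases (Finset.univ.filter (· ≠ Fin.last m)).eq_empty_or_nonempty with he | hne
    · exact ⟨1, one_pos, by simp [he]⟩
    · obtain ⟨b, hb, hmin⟩ := Finset.exists_min_image _ (fun a => lam (Fin.last m) - lam a) hne
      exact ⟨_, sub_pos.2 (hlt b (Finset.mem_filter.1 hb).2), hmin⟩
  exact ⟨δ, hδ, fun a ha => by linarith [h a (by simp [ha])]⟩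

/-- The top eigenvectors of a convergent sequence of matrices, when the limit has a simple largest
eigenvalue: they are asymptotically parallel to that of the limit. -/
theorem tendsto_inner_top_sq {m : ℕ} {A : Matrix (Fin (m + 1)) (Fin (m + 1)) ℝ}
    {lam : Fin (m + 1) → ℝ} {gam : Fin (m + 1) → Vec m} (hA : IsOrderedEigensystem A lam gam)
    (hsimple : ∀ a, lam a = lam (Fin.last m) → a = Fin.last m)
    {B : ℕ → Matrix (Fin (m + 1)) (Fin (m + 1)) ℝ} {d : ℕ → Fin (m + 1) → ℝ}
    {g : ℕ → Fin (m + 1) → Vec m} (hB : ∀ n, IsOrderedEigensystem (B n) (d n) (g n))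
    (hlim : ∀ i j, Tendsto (fun n => B n i j) atTop (𝓝 (A i j))) :
    Tendsto (fun n => inner ℝ (gam (Fin.last m)) (g n (Fin.last m)) ^ 2) atTop (𝓝 1) ∧
      ∀ᶠ n in atTop, ∀ a, d n a = d n (Fin.last m) → a = Fin.last m := by
  obtain ⟨δ, hδ, hgap⟩ := exists_eigenvalue_gap hA.monotone hsimple
  set ε : ℕ → ℝ := fun n => δ⁻¹ * (2 * ∑ i, ∑ j, |(B n - A) i j|)
  have hε : Tendsto ε atTop (𝓝 0) := by
    have : Tendsto (fun n => ∑ i, ∑ j, |(B n - A) i j|) atTop (𝓝 (∑ i, ∑ j, |(A - A) i j|)) :=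
      tendsto_finsetSum _ fun i _ => tendsto_finsetSum _ fun j _ =>
        ((hlim i j).sub_const (A i j)).abs
    simpa [ε] using (this.const_mul 2).const_mul δ⁻¹
  have hlow : ∀ n c, d n c = d n (Fin.last m) →
      1 - ε n ≤ inner ℝ (gam (Fin.last m)) (g n c) ^ 2 := fun n c hc => by
    have := gap_mul_one_sub_inner_sq_le hA (hB n) hgap hc
    rw [← le_inv_mul_iff₀ hδ] at this
    linarith
  have hsum : ∀ n, ∑ a, inner ℝ (gam (Fin.last m)) (g n a) ^ 2 = 1 := fun n => by
    simp only [fun a => real_inner_comm (g n a) (gam (Fin.last m)), (hB n).sum_inner_sq,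
      hA.norm_eq_one, one_pow]
  constructor
  · refine tendsto_of_tendsto_of_tendsto_of_le_of_le (g := fun n => 1 - ε n) (h := fun _ => 1)
      (by simpa using hε.const_sub 1) tendsto_const_nhds (fun n => hlow n _ rfl) fun n => ?_
    rw [← hsum n]
    exact Finset.single_le_sum (f := fun a => inner ℝ (gam (Fin.last m)) (g n a) ^ 2)
      (fun a _ => sq_nonneg _) (Finset.mem_univ (Fin.last m))
  -- Two distinct eigenvectors for the top eigenvalue would both have squared inner product above
  -- 1/2 with the same unit vector, contradicting Parseval.
  · filter_upwards [hε.eventually_lt_const (show (0 : ℝ) < 1 / 2 by norm_num)] with n hn a ha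
    by_contra hne
    have h2 : inner ℝ (gam (Fin.last m)) (g n a) ^ 2
        + inner ℝ (gam (Fin.last m)) (g n (Fin.last m)) ^ 2 ≤ 1 := by
      rw [← hsum n, ← Finset.sum_pair (f := fun a => inner ℝ (gam (Fin.last m)) (g n a) ^ 2) hne]
      exact Finset.sum_le_sum_of_subset_of_nonneg (Finset.subset_univ _) fun a _ _ => sq_nonneg _
    linarith [hlow n a ha, hlow n _ rfl]

/-- One negative value forces all the others to be nonpositive. This turns the pairwise orientation
condition into a single sign for all factors. -/
theorem exists_common_sign {ι : Type*} (x : ι → ℝ) (h : ∀ s t, 0 ≤ x s * x t) :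
    ∃ σ : ℝ, σ ^ 2 = 1 ∧ ∀ s, σ * x s = |x s| := by
  by_cases hneg : ∃ s, x s < 0
  · obtain ⟨s₀, hs₀⟩ := hneg
    refine ⟨-1, by norm_num, fun s => ?_⟩
    rw [abs_of_nonpos (by nlinarith [h s s₀]), neg_one_mul]
  · push Not at hneg
    exact ⟨1, by norm_num, fun s => by rw [abs_of_nonneg (hneg s), one_mul]⟩

/-- A quadratic form in the inverse of a matrix is invariant under a change of coordinates. -/
theorem dotProduct_inv_mulVec_congr {κ : Type*} [Fintype κ] [DecidableEq κ] (T G : Matrix κ κ ℝ)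
    (h : (T * G * T.transpose).det ≠ 0) (v : κ → ℝ) :
    v ⬝ᵥ G⁻¹.mulVec v = T.mulVec v ⬝ᵥ (T * G * T.transpose)⁻¹.mulVec (T.mulVec v) := by
  rw [Matrix.det_mul, Matrix.det_mul, Matrix.det_transpose] at h
  -- Only `T` has to be inverted in what follows; `Matrix.mul_inv_rev` needs no invertibility.
  have hT : IsUnit T.det := (left_ne_zero_of_mul (left_ne_zero_of_mul h)).isUnit
  have hT' : T.transpose * T.transpose⁻¹ = 1 :=
    Matrix.mul_nonsing_inv _ (by rwa [Matrix.det_transpose])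
  rw [Matrix.mul_inv_rev, Matrix.mul_inv_rev, Matrix.mulVec_mulVec, Matrix.mul_assoc,
    Matrix.mul_assoc, Matrix.nonsing_inv_mul _ hT, Matrix.mul_one, ← Matrix.mulVec_mulVec,
    Matrix.dotProduct_mulVec (T.mulVec v), ← Matrix.vecMul_transpose T v, Matrix.vecMul_vecMul, hT',
    Matrix.vecMul_one]

/-! ### Passage from the sample frame to the population frame. -/

variable {m q : ℕ}

/-- The change of coordinates from the sample frame `g`, scaled by the spectral gaps, to the
population frame `gam`. -/
def alignMatrix (gam : Fin q → Fin (m + 1) → Vec m) (d : Fin q → Fin (m + 1) → ℝ)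
    (g : Fin q → Fin (m + 1) → Vec m) : Matrix (Fin q × Fin m) (Fin q × Fin m) ℝ :=
  Matrix.of fun i j => if i.1 = j.1 then
    inner ℝ (gam i.1 i.2.castSucc) (g i.1 j.2.castSucc)
      * (d i.1 (Fin.last m) - d i.1 j.2.castSucc) else 0

/-- The tangential coordinates of the projector on `x`, in the frame `gam`. -/
def tangentScore (gam : Fin q → Fin (m + 1) → Vec m) (x : Fin q → Vec m) : Fin q × Fin m → ℝ :=
  fun i => inner ℝ (gam i.1 i.2.castSucc) (x i.1) * inner ℝ (gam i.1 (Fin.last m)) (x i.1)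

/-- The tangential coordinates of the projector on `x` at the points `γ`, along the orthogonal
projections of the frame `gam`. -/
def projectedScore (gam : Fin q → Fin (m + 1) → Vec m) (γ : Fin q → Vec m) (x : Fin q → Vec m) :
    Fin q × Fin m → ℝ :=
  fun i => inner ℝ (gam i.1 i.2.castSucc - inner ℝ (gam i.1 i.2.castSucc) (γ i.1) • γ i.1) (x i.1)
    * inner ℝ (γ i.1) (x i.1)

theorem alignMatrix_mulVec (gam : Fin q → Fin (m + 1) → Vec m) (d : Fin q → Fin (m + 1) → ℝ)
    (g : Fin q → Fin (m + 1) → Vec m) (v : Fin q × Fin m → ℝ) (s : Fin q) (a : Fin m) :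
    (alignMatrix gam d g).mulVec v (s, a) = ∑ c : Fin m,
      inner ℝ (gam s a.castSucc) (g s c.castSucc) * (d s (Fin.last m) - d s c.castSucc)
        * v (s, c) := by
  simp only [alignMatrix, Matrix.mulVec, dotProduct, Matrix.of_apply, Fintype.sum_prod_type,
    ite_mul, zero_mul]
  rw [Finset.sum_comm]
  simp

theorem dotProduct_sampleMomentMatrix_mulVec (n : ℕ) (x : ℕ → Vec m) (u w : Vec m) :
    u.ofLp ⬝ᵥ (sampleMomentMatrix n x).mulVec w.ofLp =
      (n : ℝ)⁻¹ * ∑ r ∈ Finset.range n, inner ℝ u (x r) * inner ℝ w (x r) := by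
  simp only [sampleMomentMatrix, Matrix.smul_mulVec, Matrix.sum_mulVec, Matrix.vecMulVec_mulVec,
    dotProduct_smul, dotProduct_sum, smul_eq_mul]
  congr 1
  refine Finset.sum_congr rfl fun r _ => ?_
  simp [PiLp.inner_apply, dotProduct, mul_comm]

/-- The weight `d_top - d_c` vanishes at the top index, so the sum extends to the full frame. It
then equals `d_top` times an inner product that is zero by orthogonality, minus the bilinear form of
`J_s` at the two population vectors. -/
theorem alignMatrix_mulVec_tangentCoords {n : ℕ} {x : ℕ → Fin q → Vec m}
    {gam : Fin q → Fin (m + 1) → Vec m} {d : Fin q → Fin (m + 1) → ℝ}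
    {g : Fin q → Fin (m + 1) → Vec m}
    (hgam : ∀ s, Orthonormal ℝ (gam s))
    (h : ∀ s, IsOrderedEigensystem (sampleMomentMatrix n fun r => x r s) (d s) (g s)) :
    (alignMatrix gam d g).mulVec (tangentCoords (fun s => gam s (Fin.last m)) g) =
      -((n : ℝ)⁻¹ • ∑ r ∈ Finset.range n, tangentScore gam (x r)) := by
  ext ⟨s, a⟩
  have h1 := (h s).sum_inner_mul_inner (gam s a.castSucc) (gam s (Fin.last m))
  have h2 := (h s).dotProduct_mulVec (gam s a.castSucc) (gam s (Fin.last m))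
  rw [dotProduct_sampleMomentMatrix_mulVec] at h2
  rw [(hgam s).2 (Fin.castSucc_lt_last a).ne, Fin.sum_univ_castSucc] at h1
  rw [Fin.sum_univ_castSucc] at h2
  rw [alignMatrix_mulVec]
  simp only [Pi.neg_apply, Pi.smul_apply, Finset.sum_apply, smul_eq_mul, tangentScore,
    tangentCoords, h2]
  have h3 : ∀ c : Fin m, inner ℝ (gam s a.castSucc) (g s c.castSucc)
      * (d s (Fin.last m) - d s c.castSucc) * inner ℝ (gam s (Fin.last m)) (g s c.castSucc) =
      d s (Fin.last m) * (inner ℝ (gam s a.castSucc) (g s c.castSucc)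
        * inner ℝ (g s c.castSucc) (gam s (Fin.last m)))
      - d s c.castSucc * (inner ℝ (gam s a.castSucc) (g s c.castSucc)
        * inner ℝ (g s c.castSucc) (gam s (Fin.last m))) := fun c => by
    rw [real_inner_comm (g s c.castSucc) (gam s (Fin.last m))]
    ring
  simp only [h3, Finset.sum_sub_distrib, ← Finset.mul_sum]
  linear_combination d s (Fin.last m) * h1

/-- `G` is an average of outer products. Simplicity lets the gaps in `alignMatrix` cancel their
reciprocals, and Parseval over the lower vectors leaves the projection orthogonal to the top one. -/
theorem alignMatrix_mul_studentMatrix_mul {n : ℕ} {x : ℕ → Fin q → Vec m}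
    {gam : Fin q → Fin (m + 1) → Vec m} {d : Fin q → Fin (m + 1) → ℝ}
    {g : Fin q → Fin (m + 1) → Vec m}
    (h : ∀ s, IsOrderedEigensystem (sampleMomentMatrix n fun r => x r s) (d s) (g s))
    (hsimple : ∀ s a, d s a = d s (Fin.last m) → a = Fin.last m) :
    alignMatrix gam d g * studentMatrix n x d g * (alignMatrix gam d g).transpose =
      (n : ℝ)⁻¹ • ∑ r ∈ Finset.range n,
        Matrix.vecMulVec (projectedScore gam (fun s => g s (Fin.last m)) (x r))
          (projectedScore gam (fun s => g s (Fin.last m)) (x r)) := by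
  set w : ℕ → Fin q × Fin m → ℝ := fun r i =>
    (d i.1 (Fin.last m) - d i.1 i.2.castSucc)⁻¹ * inner ℝ (g i.1 i.2.castSucc) (x r i.1)
      * inner ℝ (g i.1 (Fin.last m)) (x r i.1) with hw
  have hG : studentMatrix n x d g =
      (n : ℝ)⁻¹ • ∑ r ∈ Finset.range n, Matrix.vecMulVec (w r) (w r) := by
    ext i j
    simp only [studentMatrix, Matrix.of_apply, Matrix.smul_apply, Matrix.sum_apply,
      Matrix.vecMulVec_apply, smul_eq_mul, hw, mul_assoc, Finset.mul_sum]
    exact Finset.sum_congr rfl fun r _ => by ring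
  have hTw : ∀ r, (alignMatrix gam d g).mulVec (w r) =
      projectedScore gam (fun s => g s (Fin.last m)) (x r) := fun r => by
    ext ⟨s, a⟩
    have h1 := (h s).sum_inner_mul_inner (gam s a.castSucc) (x r s)
    rw [Fin.sum_univ_castSucc, ← eq_sub_iff_add_eq] at h1
    simp only [alignMatrix_mulVec, projectedScore, inner_sub_left, real_inner_smul_left, hw]
    rw [← h1, Finset.sum_mul]
    refine Finset.sum_congr rfl fun c _ => ?_
    have hne : d s (Fin.last m) - d s c.castSucc ≠ 0 := fun h0 =>
      (Fin.castSucc_lt_last c).ne (hsimple s _ (sub_eq_zero.1 h0).symm)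
    field_simp
  rw [hG]
  simp only [Matrix.mul_smul, Matrix.smul_mul, Matrix.mul_sum, Matrix.sum_mul,
    Matrix.mul_vecMulVec, Matrix.vecMulVec_mul, Matrix.vecMul_transpose, hTw]

/-! ### Bounds and stability of the scores. -/

theorem abs_tangentScore_le {gam : Fin q → Fin (m + 1) → Vec m} (hgam : ∀ s a, ‖gam s a‖ = 1)
    {x : Fin q → Vec m} (hx : ∀ s, ‖x s‖ = 1) (i : Fin q × Fin m) : |tangentScore gam x i| ≤ 1 := by
  rw [tangentScore, abs_mul]
  refine mul_le_one₀ ?_ (abs_nonneg _) ?_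
  all_goals
    refine (abs_real_inner_le_norm _ _).trans_eq ?_
    rw [hgam, hx, one_mul]

/-- A sign common to all factors multiplies every coordinate by `σ`, so products of two coordinates
do not change. -/
theorem projectedScore_smul {σ : ℝ} (hσ : σ ^ 2 = 1) (gam : Fin q → Fin (m + 1) → Vec m)
    (γ x : Fin q → Vec m) (i : Fin q × Fin m) :
    projectedScore gam (fun s => σ • γ s) x i = σ * projectedScore gam γ x i := by
  simp only [projectedScore, real_inner_smul_left, real_inner_smul_right, smul_smul]
  have hc : σ * inner ℝ (gam i.1 i.2.castSucc) (γ i.1) * σ =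
      inner ℝ (gam i.1 i.2.castSucc) (γ i.1) := by
    linear_combination (inner ℝ (gam i.1 i.2.castSucc) (γ i.1) : ℝ) * hσ
  rw [hc]
  ring

theorem abs_projectedScore_sub_le {gam : Fin q → Fin (m + 1) → Vec m}
    (hgam : ∀ s, Orthonormal ℝ (gam s)) {γ x : Fin q → Vec m} (hγ : ∀ s, ‖γ s‖ = 1)
    (hx : ∀ s, ‖x s‖ = 1) (i : Fin q × Fin m) :
    |projectedScore gam γ x i - tangentScore gam x i| ≤ 2 * ‖γ i.1 - gam i.1 (Fin.last m)‖ := by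
  obtain ⟨s, a⟩ := i
  have h0 : inner ℝ (gam s a.castSucc) (gam s (Fin.last m)) = 0 :=
    (hgam s).2 (Fin.castSucc_lt_last a).ne
  -- By `h0`, the inner product of the lower vector with `γ` is that with the increment `γ -
  -- gam_top`; each of the two terms is then at most the norm of the increment.
  have e : projectedScore gam γ x (s, a) - tangentScore gam x (s, a) =
      inner ℝ (gam s a.castSucc) (x s) * inner ℝ (γ s - gam s (Fin.last m)) (x s)
      - inner ℝ (gam s a.castSucc) (γ s - gam s (Fin.last m))
        * (inner ℝ (γ s) (x s) * inner ℝ (γ s) (x s)) := by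
    simp only [projectedScore, tangentScore, inner_sub_left, inner_sub_right,
      real_inner_smul_left, h0]
    ring
  have b : ∀ u w : Vec m, ‖u‖ = 1 → |inner ℝ u w| ≤ ‖w‖ := fun u w hu => by
    simpa [hu] using abs_real_inner_le_norm u w
  have b1 := b _ (x s) ((hgam s).1 a.castSucc)
  have b2 := b _ (γ s - gam s (Fin.last m)) (hx s)
  have b3 := b _ (γ s - gam s (Fin.last m)) ((hgam s).1 a.castSucc)
  have b4 := b _ (x s) (hγ s)
  rw [hx s] at b1 b4
  rw [real_inner_comm] at b2
  rw [e]
  refine (abs_sub _ _).trans ?_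
  rw [abs_mul, abs_mul, abs_mul]
  calc _ ≤ 1 * ‖γ s - gam s (Fin.last m)‖ + ‖γ s - gam s (Fin.last m)‖ * (1 * 1) := by
        gcongr
    _ = _ := by ring

theorem abs_projectedScore_mul_sub_le {gam : Fin q → Fin (m + 1) → Vec m}
    (hgam : ∀ s, Orthonormal ℝ (gam s)) {γ x : Fin q → Vec m} (hγ : ∀ s, ‖γ s‖ = 1)
    (hx : ∀ s, ‖x s‖ = 1) (i j : Fin q × Fin m) :
    |projectedScore gam γ x i * projectedScore gam γ x j
        - tangentScore gam x i * tangentScore gam x j| ≤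
      10 * (‖γ i.1 - gam i.1 (Fin.last m)‖ + ‖γ j.1 - gam j.1 (Fin.last m)‖) := by
  have hi := abs_projectedScore_sub_le hgam hγ hx i
  have hj := abs_projectedScore_sub_le hgam hγ hx j
  have ti := abs_tangentScore_le (fun s => (hgam s).1) hx i
  have tj := abs_tangentScore_le (fun s => (hgam s).1) hx j
  have hi2 : ‖γ i.1 - gam i.1 (Fin.last m)‖ ≤ 2 := by
    refine (norm_sub_le _ _).trans ?_
    rw [hγ, (hgam _).1]; norm_num
  rw [show projectedScore gam γ x i * projectedScore gam γ x j
      - tangentScore gam x i * tangentScore gam x j =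
      (projectedScore gam γ x i - tangentScore gam x i)
        * (projectedScore gam γ x j - tangentScore gam x j)
      + tangentScore gam x i * (projectedScore gam γ x j - tangentScore gam x j)
      + (projectedScore gam γ x i - tangentScore gam x i) * tangentScore gam x j by ring]
  refine (abs_add_three _ _ _).trans ?_
  rw [abs_mul, abs_mul, abs_mul]
  have := norm_nonneg (γ i.1 - gam i.1 (Fin.last m))
  have := norm_nonneg (γ j.1 - gam j.1 (Fin.last m))
  -- The product of the two errors uses the crude bound 4 on the first, so the coefficients are 8 +
  -- 2 and 2, all at most 10.
  calc _ ≤ (2 * 2) * (2 * ‖γ j.1 - gam j.1 (Fin.last m)‖)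
        + 1 * (2 * ‖γ j.1 - gam j.1 (Fin.last m)‖)
        + 2 * ‖γ i.1 - gam i.1 (Fin.last m)‖ * 1 := by
        gcongr
        exact hi.trans (by linarith)
    _ ≤ _ := by linarith

/-! ### The central limit theorem and the chi-square limit. -/

theorem charFun_map_eq_charFun_map_inner {Ω E : Type*} [MeasurableSpace Ω] {P : Measure Ω}
    [NormedAddCommGroup E] [InnerProductSpace ℝ E] [MeasurableSpace E] [BorelSpace E]
    [SecondCountableTopology E] {U : Ω → E} (hU : AEMeasurable U P) (t : E) :
    charFun (P.map U) t = charFun (P.map fun ω => inner ℝ (U ω) t) 1 := by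
  rw [charFun_apply, charFun_apply, integral_map hU (by fun_prop),
    integral_map (by fun_prop) (by fun_prop)]
  simp

/-- The multivariate central limit theorem for standardized vectors (Cramér–Wold). -/
theorem tendstoInDistribution_stdGaussian {Ω ι : Type*} [Fintype ι] [MeasurableSpace Ω]
    {P : Measure Ω} [IsProbabilityMeasure P] {ξ : ℕ → Ω → EuclideanSpace ℝ ι}
    (hindep : iIndepFun ξ P) (hident : ∀ r, IdentDistrib (ξ r) (ξ 0) P P)
    (hL2 : ∀ t, MemLp (fun ω => inner ℝ (ξ 0 ω) t) 2 P)
    (hmean : ∀ t, ∫ ω, inner ℝ (ξ 0 ω) t ∂P = 0)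
    (hvar : ∀ t, Var[fun ω => inner ℝ (ξ 0 ω) t; P] = ‖t‖ ^ 2) :
    TendstoInDistribution (fun (n : ℕ) ω => (√n)⁻¹ • ∑ r ∈ Finset.range n, ξ r ω) atTop
      (id : EuclideanSpace ℝ ι → _) (fun _ => P) (stdGaussian (EuclideanSpace ℝ ι)) := by
  have hmeas : ∀ n : ℕ, AEMeasurable (fun ω => (√n)⁻¹ • ∑ r ∈ Finset.range n, ξ r ω) P := fun n =>
    AEMeasurable.fun_const_smul (g := fun ω => ∑ r ∈ Finset.range n, ξ r ω)
      (Finset.aemeasurable_fun_sum _ fun r _ => (hident r).aemeasurable_fst) _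
  refine ⟨hmeas, aemeasurable_id, ProbabilityMeasure.tendsto_iff_tendsto_charFun.2 fun t => ?_⟩
  have hclt := tendstoInDistribution_inv_sqrt_mul_sum_sub
    (X := fun r ω => inner ℝ (ξ r ω) t) (P := P) (Y := (id : ℝ → ℝ)) HasLaw.id (hL2 t)
    (hindep.comp (fun _ x => inner ℝ x t) fun _ => by fun_prop)
    (fun r => (hident r).comp (u := fun x => inner ℝ x t) (by fun_prop))
  have h := ProbabilityMeasure.tendsto_iff_tendsto_charFun.1 hclt.tendsto 1
  simp only [ProbabilityMeasure.coe_mk, Measure.map_id, charFun_gaussianReal, hvar, hmean,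
    charFun_stdGaussian] at h ⊢
  refine (h.congr fun n => ?_).trans ?_
  · rw [charFun_map_eq_charFun_map_inner (hmeas n)]
    simp [real_inner_smul_left, sum_inner]
  · simp [neg_div]

theorem map_norm_sq_stdGaussian {ι : Type*} [Fintype ι] {k : ℕ} (hk : Fintype.card ι = k) :
    (stdGaussian (EuclideanSpace ℝ ι)).map (fun z => ‖z‖ ^ 2) = chiSquare k := by
  let f : EuclideanSpace ℝ ι ≃ₗᵢ[ℝ] EuclideanSpace ℝ (Fin k) :=
    LinearIsometryEquiv.piLpCongrLeft 2 ℝ ℝ (Fintype.equivFinOfCardEq hk)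
  have h : (fun z : EuclideanSpace ℝ ι => ‖z‖ ^ 2) = (fun z => ‖z‖ ^ 2) ∘ f := by
    ext z; simp
  have h2 : (fun z : EuclideanSpace ℝ (Fin k) => ‖z‖ ^ 2) ∘ (WithLp.toLp 2) =
      fun z : Fin k → ℝ => ∑ i, z i ^ 2 := by
    ext z; simp [EuclideanSpace.norm_sq_eq]
  rw [h, ← Measure.map_map (by fun_prop) (by fun_prop), stdGaussian_map, ← map_pi_eq_stdGaussian,
    Measure.map_map (by fun_prop) (by fun_prop), h2, chiSquare]

/-- A quadratic form in the inverse of a consistent estimator of the identity matrix, at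
standardized sums, is asymptotically chi-square distributed. -/
theorem tendstoInDistribution_chiSquare {Ω ι : Type*} [Fintype ι] [DecidableEq ι]
    [MeasurableSpace Ω] {P : Measure Ω} [IsProbabilityMeasure P] {k : ℕ}
    (hk : Fintype.card ι = k) {U : ℕ → Ω → EuclideanSpace ℝ ι}
    (hU : TendstoInDistribution U atTop (id : EuclideanSpace ℝ ι → _) (fun _ => P)
      (stdGaussian (EuclideanSpace ℝ ι)))
    {N : ℕ → Ω → Matrix ι ι ℝ} (hN : ∀ n i j, AEMeasurable (fun ω => N n ω i j) P)
    (hlim : ∀ᵐ ω ∂P, Tendsto (fun n => N n ω) atTop (𝓝 1))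
    {T : ℕ → Ω → ℝ} (hT : ∀ n, AEMeasurable (T n) P)
    (hTU : ∀ᵐ ω ∂P, ∀ᶠ n in atTop,
      T n ω = (U n ω).ofLp ⬝ᵥ (N n ω).mulVec (U n ω).ofLp) :
    TendstoInDistribution T atTop (id : ℝ → ℝ) (fun _ => P) (chiSquare k) := by
  let F : EuclideanSpace ℝ ι × (ι → ι → ℝ) → ℝ := fun p => p.1.ofLp ⬝ᵥ Matrix.mulVec p.2 p.1.ofLp
  have hF : Continuous F := by
    simp only [F, Matrix.mulVec, dotProduct]
    fun_prop
  have hN' : ∀ n, AEMeasurable (fun ω i j => N n ω i j) P := fun n =>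
    aemeasurable_pi_lambda _ fun i => aemeasurable_pi_lambda _ fun j => hN n i j
  -- Slutsky's theorem for the quadratic form; `h2` then replaces it by `T`, which eventually
  -- coincides with it almost surely.
  have h1 := hU.continuous_comp_prodMk_of_tendstoInMeasure_const hF
    (tendstoInMeasure_of_tendsto_ae (fun n => (hN' n).aestronglyMeasurable) hlim) hN'
  have h2 : TendstoInDistribution T atTop (fun z => F (id z, (1 : Matrix ι ι ℝ))) (fun _ => P)
      (stdGaussian (EuclideanSpace ℝ ι)) := by
    refine tendstoInDistribution_of_tendstoInMeasure_sub T _ h1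
      (tendstoInMeasure_of_tendsto_ae (fun n =>
        ((hT n).sub (h1.forall_aemeasurable n)).aestronglyMeasurable) ?_) hT
    filter_upwards [hTU] with ω hω
    refine tendsto_const_nhds.congr' ?_
    filter_upwards [hω] with n hn
    simp [F, hn]
  have h3 : (fun z : EuclideanSpace ℝ ι => F (id z, (1 : Matrix ι ι ℝ))) = fun z => ‖z‖ ^ 2 := by
    ext z
    simp only [F, id, EuclideanSpace.norm_sq_eq, Real.norm_eq_abs, sq_abs]
    erw [Matrix.one_mulVec]
    simp [dotProduct, sq]
  rw [h3] at h2
  refine ⟨hT, aemeasurable_id, ?_⟩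
  convert! h2.tendsto using 2
  exact congrArg 𝓝 (Subtype.ext (Measure.map_id.trans (map_norm_sq_stdGaussian hk).symm))

/-! ### Matrix inversion and whitening. -/

/-- Inversion of square matrices is measurable. -/
theorem measurable_matrix_inv {ι : Type*} [Fintype ι] [DecidableEq ι] :
    Measurable fun A : ι → ι → ℝ => Matrix.of.symm (Matrix.of A)⁻¹ := by
  have hd : Continuous fun A : ι → ι → ℝ => (Matrix.of A).det :=
    Continuous.matrix_det (A := fun A : ι → ι → ℝ => Matrix.of A) continuous_id
  have ha : Continuous fun A : ι → ι → ℝ => (Matrix.of A).adjugate :=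
    Continuous.matrix_adjugate (A := fun A : ι → ι → ℝ => Matrix.of A) continuous_id
  -- This formula also covers singular matrices, since both sides are then 0.
  have : ∀ A : ι → ι → ℝ, ((Matrix.of A)⁻¹ : Matrix ι ι ℝ) =
      ((Matrix.of A).det)⁻¹ • (Matrix.of A).adjugate := fun A => by
    rw [Matrix.inv_def, Ring.inverse_eq_inv']
  refine measurable_pi_lambda _ fun i => measurable_pi_lambda _ fun j => ?_
  simp only [this, Matrix.of_symm_apply, Matrix.smul_apply, smul_eq_mul]
  exact hd.measurable.inv.mul
    (ha.matrix_elem i j).measurable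

theorem tendsto_matrix_inv_one {ι : Type*} [Fintype ι] [DecidableEq ι]
    {A : ℕ → Matrix ι ι ℝ} (h : Tendsto A atTop (𝓝 1)) :
    Tendsto (fun n => (A n)⁻¹) atTop (𝓝 1) ∧ ∀ᶠ n in atTop, (A n).det ≠ 0 := by
  have hd : Tendsto (fun n => (A n).det) atTop (𝓝 1) := by
    simpa [Function.comp_def] using ((continuous_id.matrix_det).tendsto (1 : Matrix ι ι ℝ)).comp h
  have ha : Tendsto (fun n => (A n).adjugate) atTop (𝓝 1) := by
    simpa [Function.comp_def] using ((continuous_id.matrix_adjugate).tendsto (1 : Matrix ι ι ℝ)).comp h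
  refine ⟨?_, hd.eventually_ne one_ne_zero⟩
  have := (hd.inv₀ one_ne_zero).smul ha
  rw [inv_one, one_smul] at this
  exact this.congr fun n => by rw [Matrix.inv_def, Ring.inverse_eq_inv']

open scoped MatrixOrder in
/-- A positive definite matrix can be whitened. -/
theorem exists_whitening {ι : Type*} [Fintype ι] [DecidableEq ι] {C : Matrix ι ι ℝ}
    (hC : C.PosSemidef) (hdet : C.det ≠ 0) :
    ∃ B : Matrix ι ι ℝ, B * C * B.transpose = 1 := by
  obtain ⟨A, rfl⟩ := CStarAlgebra.nonneg_iff_eq_star_mul_self.1 hC.nonneg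
  rw [Matrix.star_eq_conjTranspose, Matrix.conjTranspose_eq_transpose_of_trivial] at hdet ⊢
  have hA : IsUnit A.det := by
    rw [Matrix.det_mul] at hdet
    exact (right_ne_zero_of_mul hdet).isUnit
  -- With `C = Aᵀ A`, the inverse of `Aᵀ` whitens.
  refine ⟨A.transpose⁻¹, ?_⟩
  rw [← Matrix.mul_assoc, Matrix.nonsing_inv_mul _ (by rwa [Matrix.det_transpose]), Matrix.one_mul,
    ← Matrix.transpose_nonsing_inv, Matrix.transpose_transpose, Matrix.mul_nonsing_inv _ hA]

/-! ### Consistency of the studentizing matrix and the exact form of the statistic. -/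

/-- For unit vectors the squared distance is `2 - 2|⟪u, h⟫|` once the sign is adjusted. -/
theorem tendsto_norm_smul_sub {E : Type*} [NormedAddCommGroup E] [InnerProductSpace ℝ E]
    {σ : ℕ → ℝ} (hσ : ∀ n, σ n ^ 2 = 1) {u : E} (hu : ‖u‖ = 1) {h : ℕ → E} (hh : ∀ n, ‖h n‖ = 1)
    (habs : ∀ n, σ n * inner ℝ u (h n) = |inner ℝ u (h n)|)
    (hlim : Tendsto (fun n => (inner ℝ u (h n) : ℝ) ^ 2) atTop (𝓝 1)) :
    Tendsto (fun n => ‖σ n • h n - u‖) atTop (𝓝 0) := by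
  have h1 : ∀ n, ‖σ n • h n - u‖ = √(2 - 2 * √((inner ℝ u (h n) : ℝ) ^ 2)) := fun n => by
    rw [Real.sqrt_sq_eq_abs, ← habs, ← Real.sqrt_sq (norm_nonneg (σ n • h n - u)),
      norm_sub_sq_real, norm_smul, mul_pow, Real.norm_eq_abs, sq_abs, hσ, hh, hu,
      real_inner_smul_left, real_inner_comm]
    ring_nf
  simp only [h1]
  have := ((hlim.sqrt.const_mul 2).const_sub 2).sqrt
  simpa using this

/-- Consistency of the studentizing matrix, expressed in the population frame. -/
theorem tendsto_alignMatrix_mul_studentMatrix {x : ℕ → Fin q → Vec m} (hx : ∀ r s, ‖x r s‖ = 1)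
    {A : Fin q → Matrix (Fin (m + 1)) (Fin (m + 1)) ℝ}
    {lam : Fin q → Fin (m + 1) → ℝ} {gam : Fin q → Fin (m + 1) → Vec m}
    (hpop : ∀ s, IsOrderedEigensystem (A s) (lam s) (gam s))
    (hsimple : ∀ s a, lam s a = lam s (Fin.last m) → a = Fin.last m)
    {d : ℕ → Fin q → Fin (m + 1) → ℝ} {g : ℕ → Fin q → Fin (m + 1) → Vec m}
    (hsample : ∀ n s, IsOrderedEigensystem (sampleMomentMatrix n fun r => x r s) (d n s) (g n s))
    (hsign : ∀ n s t, 0 ≤ inner ℝ (gam s (Fin.last m)) (g n s (Fin.last m))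
      * inner ℝ (gam t (Fin.last m)) (g n t (Fin.last m)))
    (hA : ∀ s i j, Tendsto (fun n => sampleMomentMatrix n (fun r => x r s) i j) atTop
      (𝓝 (A s i j)))
    {C : Matrix (Fin q × Fin m) (Fin q × Fin m) ℝ}
    (hC : ∀ i j, Tendsto (fun n : ℕ => (n : ℝ)⁻¹ *
      ∑ r ∈ Finset.range n, tangentScore gam (x r) i * tangentScore gam (x r) j) atTop
      (𝓝 (C i j))) :
    Tendsto (fun n => alignMatrix gam (d n) (g n) * studentMatrix n x (d n) (g n)
      * (alignMatrix gam (d n) (g n)).transpose) atTop (𝓝 C) := by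
  have htop := fun s => tendsto_inner_top_sq (hpop s) (hsimple s) (fun n => hsample n s) (hA s)
  have hev : ∀ᶠ n in atTop, ∀ s a, d n s a = d n s (Fin.last m) → a = Fin.last m :=
    eventually_all.2 fun s => (htop s).2
  choose σ hσ hσabs using fun n =>
    exists_common_sign (fun s => inner ℝ (gam s (Fin.last m)) (g n s (Fin.last m))) (hsign n)
  have he : ∀ s, Tendsto (fun n => ‖σ n • g n s (Fin.last m) - gam s (Fin.last m)‖) atTop (𝓝 0) :=
    fun s => tendsto_norm_smul_sub hσ ((hpop s).norm_eq_one _) (fun n => (hsample n s).norm_eq_one _)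
      (fun n => hσabs n s) (htop s).1
  refine tendsto_pi_nhds.2 fun i => tendsto_pi_nhds.2 fun j => ?_
  have hdiff : Tendsto (fun n : ℕ => (n : ℝ)⁻¹ * ∑ r ∈ Finset.range n,
      (projectedScore gam (fun s => σ n • g n s (Fin.last m)) (x r) i
        * projectedScore gam (fun s => σ n • g n s (Fin.last m)) (x r) j
        - tangentScore gam (x r) i * tangentScore gam (x r) j)) atTop (𝓝 0) := by
    refine squeeze_zero_norm (a := fun n => 10 * (‖σ n • g n i.1 (Fin.last m) - gam i.1 (Fin.last m)‖
      + ‖σ n • g n j.1 (Fin.last m) - gam j.1 (Fin.last m)‖)) (fun n => ?_)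
      (by simpa using ((he i.1).add (he j.1)).const_mul 10)
    have hnorm : ∀ s, ‖σ n • g n s (Fin.last m)‖ = 1 := fun s => by
      rw [norm_smul, (hsample n s).norm_eq_one, mul_one, Real.norm_eq_abs,
        ← Real.sqrt_sq_eq_abs, hσ, Real.sqrt_one]
    rw [norm_mul, norm_inv, Real.norm_natCast]
    refine (mul_le_mul_of_nonneg_left (norm_sum_le_of_le _ fun r _ =>
      abs_projectedScore_mul_sub_le (fun s => (hpop s).orthonormal) hnorm (hx r) i j)
      (by positivity)).trans ?_
    rw [Finset.sum_const, Finset.card_range, nsmul_eq_mul, ← mul_assoc]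
    refine mul_le_of_le_one_left (by positivity) ?_
    exact inv_mul_le_one
  have hsum := hdiff.add (hC i j)
  rw [zero_add] at hsum
  refine hsum.congr' ?_
  filter_upwards [hev] with n hn
  rw [alignMatrix_mul_studentMatrix_mul (hsample n) hn, ← mul_add, ← Finset.sum_add_distrib]
  simp only [Matrix.smul_apply, Matrix.sum_apply, Matrix.vecMulVec_apply, smul_eq_mul,
    projectedScore_smul (hσ n), sub_add_cancel]
  congr 1
  refine Finset.sum_congr rfl fun r _ => ?_
  linear_combination (projectedScore gam (fun s => g n s (Fin.last m)) (x r) i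
    * projectedScore gam (fun s => g n s (Fin.last m)) (x r) j) * hσ n

/-- Hotelling's statistic is a quadratic form in the mean of the tangential coordinates. -/
theorem hotellingT2_eq {n : ℕ} {x : ℕ → Fin q → Vec m}
    {gam : Fin q → Fin (m + 1) → Vec m} {d : Fin q → Fin (m + 1) → ℝ}
    {g : Fin q → Fin (m + 1) → Vec m} (hgam : ∀ s, Orthonormal ℝ (gam s))
    (h : ∀ s, IsOrderedEigensystem (sampleMomentMatrix n fun r => x r s) (d s) (g s))
    (B : Matrix (Fin q × Fin m) (Fin q × Fin m) ℝ)
    (hdet : (B * (alignMatrix gam d g * studentMatrix n x d g * (alignMatrix gam d g).transpose)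
      * B.transpose).det ≠ 0) :
    hotellingT2 n x (fun s => gam s (Fin.last m)) d g =
      ((√n)⁻¹ • ∑ r ∈ Finset.range n, B.mulVec (tangentScore gam (x r))) ⬝ᵥ
        (B * (alignMatrix gam d g * studentMatrix n x d g * (alignMatrix gam d g).transpose)
          * B.transpose)⁻¹.mulVec
          ((√n)⁻¹ • ∑ r ∈ Finset.range n, B.mulVec (tangentScore gam (x r))) := by
  have hfac : B * (alignMatrix gam d g * studentMatrix n x d g * (alignMatrix gam d g).transpose)
      * B.transpose = B * alignMatrix gam d g * studentMatrix n x d g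
        * (B * alignMatrix gam d g).transpose := by
    simp only [Matrix.transpose_mul, Matrix.mul_assoc]
  rw [hfac] at hdet ⊢
  rw [hotellingT2, dotProduct_inv_mulVec_congr _ _ hdet, ← Matrix.mulVec_mulVec,
    alignMatrix_mulVec_tangentCoords hgam h]
  simp only [Matrix.mulVec_neg, Matrix.mulVec_smul, ← Matrix.mulVec_sum, neg_dotProduct,
    dotProduct_neg, smul_dotProduct, dotProduct_smul, smul_eq_mul]
  -- Both sides vanish at `n = 0`.
  have hn : (n : ℝ) * (n : ℝ)⁻¹ * (n : ℝ)⁻¹ = (√n)⁻¹ * (√n)⁻¹ := by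
    rw [← mul_inv, Real.mul_self_sqrt n.cast_nonneg]
    rcases eq_or_ne (n : ℝ) 0 with h0 | h0
    · simp [h0]
    · field_simp
  linear_combination B.mulVec (∑ r ∈ Finset.range n, tangentScore gam (x r)) ⬝ᵥ
    (B * alignMatrix gam d g * studentMatrix n x d g
      * (B * alignMatrix gam d g).transpose)⁻¹.mulVec
      (B.mulVec (∑ r ∈ Finset.range n, tangentScore gam (x r))) * hn

/-! Measurability -/

section Measurability

variable {Ω ι : Type*} [MeasurableSpace Ω] {P : Measure Ω} [Fintype ι]

theorem aemeasurable_matrix_mul {A B : Ω → Matrix ι ι ℝ}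
    (hA : ∀ i j, AEMeasurable (fun ω => A ω i j) P)
    (hB : ∀ i j, AEMeasurable (fun ω => B ω i j) P) (i j : ι) :
    AEMeasurable (fun ω => (A ω * B ω) i j) P := by
  simp only [Matrix.mul_apply]
  exact Finset.aemeasurable_fun_sum _ fun k _ => (hA i k).mul (hB k j)

theorem aemeasurable_matrix_inv [DecidableEq ι] {A : Ω → Matrix ι ι ℝ}
    (hA : ∀ i j, AEMeasurable (fun ω => A ω i j) P) (i j : ι) :
    AEMeasurable (fun ω => (A ω)⁻¹ i j) P := by
  have h : AEMeasurable (fun ω => fun i j => A ω i j) P :=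
    aemeasurable_pi_lambda _ fun i => aemeasurable_pi_lambda _ fun j => hA i j
  exact ((measurable_pi_apply j).comp ((measurable_pi_apply i).comp
    measurable_matrix_inv)).comp_aemeasurable h

theorem inner_mul_inner_eq_sum (u w x : Vec m) :
    (inner ℝ u x * inner ℝ w x : ℝ) = ∑ i, ∑ j, u i * w j * (x i * x j) := by
  simp only [PiLp.inner_apply, Finset.sum_mul_sum]
  refine Finset.sum_congr rfl fun i _ => Finset.sum_congr rfl fun j _ => ?_
  simp
  ring

/-- The sign of a unit representative is arbitrary, so `Z` itself need not be measurable; only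
products of two of its entries are, and inner products with `Z` must occur in pairs. -/
theorem aemeasurable_inner_mul_inner {Z u w : Ω → Vec m}
    (hZ : ∀ i j, AEMeasurable (fun ω => Z ω i * Z ω j) P)
    (hu : AEMeasurable u P) (hw : AEMeasurable w P) :
    AEMeasurable (fun ω => (inner ℝ (u ω) (Z ω) * inner ℝ (w ω) (Z ω) : ℝ)) P := by
  simp only [inner_mul_inner_eq_sum]
  refine Finset.aemeasurable_fun_sum _ fun i _ => Finset.aemeasurable_fun_sum _ fun j _ => ?_
  exact AEMeasurable.mul (by fun_prop) (hZ i j)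

variable {X : ℕ → Ω → Fin q → Vec m} {n : ℕ}

/-- Each eigenvalue is the Rayleigh quotient of its eigenvector, so its measurability follows from
that of the frame. -/
theorem aemeasurable_eigenvalue {Z : ℕ → Ω → Vec m}
    (hZ : ∀ r i j, AEMeasurable (fun ω => Z r ω i * Z r ω j) P)
    {d : Ω → Fin (m + 1) → ℝ} {g : Ω → Fin (m + 1) → Vec m}
    (h : ∀ ω, IsOrderedEigensystem (sampleMomentMatrix n fun r => Z r ω) (d ω) (g ω))
    (hg : ∀ a, AEMeasurable (fun ω => g ω a) P) (a : Fin (m + 1)) :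
    AEMeasurable (fun ω => d ω a) P := by
  have : (fun ω => d ω a) = fun ω => (n : ℝ)⁻¹ * ∑ r ∈ Finset.range n,
      inner ℝ (g ω a) (Z r ω) * inner ℝ (g ω a) (Z r ω) := by
    ext ω
    rw [← dotProduct_sampleMomentMatrix_mulVec, (h ω).dotProduct_mulVec_eigenvector, if_pos rfl]
  rw [this]
  exact (Finset.aemeasurable_fun_sum _ fun r _ =>
    aemeasurable_inner_mul_inner (hZ r) (hg a) (hg a)).const_mul _

theorem aemeasurable_studentMatrix
    (hX : ∀ r s i j, AEMeasurable (fun ω => X r ω s i * X r ω s j) P)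
    {d : Ω → Fin q → Fin (m + 1) → ℝ} {g : Ω → Fin q → Fin (m + 1) → Vec m}
    (hd : ∀ s a, AEMeasurable (fun ω => d ω s a) P)
    (hg : ∀ s a, AEMeasurable (fun ω => g ω s a) P) (i j : Fin q × Fin m) :
    AEMeasurable (fun ω => studentMatrix n (fun r => X r ω) (d ω) (g ω) i j) P := by
  -- The four factors are regrouped so that each pair involves the same `X r ω s`.
  have h : ∀ ω, studentMatrix n (fun r => X r ω) (d ω) (g ω) i j =
      (n : ℝ)⁻¹ * (d ω i.1 (Fin.last m) - d ω i.1 i.2.castSucc)⁻¹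
        * (d ω j.1 (Fin.last m) - d ω j.1 j.2.castSucc)⁻¹
        * ∑ r ∈ Finset.range n,
          (inner ℝ (g ω i.1 i.2.castSucc) (X r ω i.1) * inner ℝ (g ω i.1 (Fin.last m)) (X r ω i.1))
          * (inner ℝ (g ω j.1 j.2.castSucc) (X r ω j.1)
            * inner ℝ (g ω j.1 (Fin.last m)) (X r ω j.1)) := fun ω => by
    simp only [studentMatrix, Matrix.of_apply]
    congr 1
    exact Finset.sum_congr rfl fun r _ => by ring
  simp only [h]
  refine AEMeasurable.mul ?_ (Finset.aemeasurable_fun_sum _ fun r _ =>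
    (aemeasurable_inner_mul_inner (hX r i.1) (hg _ _) (hg _ _)).mul
      (aemeasurable_inner_mul_inner (hX r j.1) (hg _ _) (hg _ _)))
  exact (((hd _ _).sub (hd _ _)).inv.const_mul _).mul ((hd _ _).sub (hd _ _)).inv

theorem aemeasurable_alignMatrix (gam : Fin q → Fin (m + 1) → Vec m)
    {d : Ω → Fin q → Fin (m + 1) → ℝ} {g : Ω → Fin q → Fin (m + 1) → Vec m}
    (hd : ∀ s a, AEMeasurable (fun ω => d ω s a) P)
    (hg : ∀ s a, AEMeasurable (fun ω => g ω s a) P) (i j : Fin q × Fin m) :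
    AEMeasurable (fun ω => alignMatrix gam (d ω) (g ω) i j) P := by
  simp only [alignMatrix, Matrix.of_apply]
  split_ifs
  · exact (aemeasurable_const.inner (hg _ _)).mul ((hd _ _).sub (hd _ _))
  · exact aemeasurable_const

theorem aemeasurable_hotellingT2
    (hX : ∀ r s i j, AEMeasurable (fun ω => X r ω s i * X r ω s j) P) (γ : Fin q → Vec m)
    {d : Ω → Fin q → Fin (m + 1) → ℝ} {g : Ω → Fin q → Fin (m + 1) → Vec m}
    (hd : ∀ s a, AEMeasurable (fun ω => d ω s a) P)
    (hg : ∀ s a, AEMeasurable (fun ω => g ω s a) P) :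
    AEMeasurable (fun ω => hotellingT2 n (fun r => X r ω) γ (d ω) (g ω)) P := by
  have hv : ∀ i, AEMeasurable (fun ω => tangentCoords γ (g ω) i) P := fun i =>
    aemeasurable_const.inner (hg _ _)
  simp only [hotellingT2, Matrix.mulVec, dotProduct]
  refine (Finset.aemeasurable_fun_sum _ fun i _ => (hv i).mul
    (Finset.aemeasurable_fun_sum _ fun j _ => ?_)).const_mul _
  exact (aemeasurable_matrix_inv (aemeasurable_studentMatrix hX hd hg) i j).mul (hv j)

end Measurability

/-! ### Scores as measurable functions on projective space. -/

/-- The entries of the projector on a line. -/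
def projectorEntry (p : RP m) (i j : Fin (m + 1)) : ℝ := p.rep i * p.rep j / ‖p.rep‖ ^ 2

theorem projectorEntry_mk (x : Vec m) (hx : x ≠ 0) (i j : Fin (m + 1)) :
    projectorEntry (Projectivization.mk ℝ x hx) i j = x i * x j / ‖x‖ ^ 2 := by
  obtain ⟨a, ha⟩ := Projectivization.exists_smul_eq_mk_rep ℝ x hx
  have ha0 : (a : ℝ) ≠ 0 := a.ne_zero
  have hn : ‖x‖ ≠ 0 := norm_ne_zero_iff.2 hx
  rw [projectorEntry, ← ha, Units.smul_def, norm_smul, mul_pow, Real.norm_eq_abs, sq_abs]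
  simp only [PiLp.smul_apply, smul_eq_mul]
  field_simp

theorem IsUnitRep.mul_eq {x : Vec m} {p : RP m} (h : IsUnitRep x p) (i j : Fin (m + 1)) :
    x i * x j = projectorEntry p i j := by
  obtain ⟨hn, hx, rfl⟩ := h
  rw [projectorEntry_mk, hn]
  simp

theorem continuous_projectorEntry (i j : Fin (m + 1)) :
    Continuous fun p : RP m => projectorEntry p i j := by
  have hq : Topology.IsQuotientMap
      (Quotient.mk (projectivizationSetoid ℝ (Vec m)) : _ → RP m) := isQuotientMap_quotient_mk'
  have h : Continuous fun v : { v : Vec m // v ≠ 0 } => v.1 i * v.1 j / ‖v.1‖ ^ 2 :=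
    Continuous.div (by fun_prop) (by fun_prop) fun v =>
      pow_ne_zero _ (norm_ne_zero_iff.2 v.2)
  exact hq.continuous_iff.2 (h.congr fun v => (projectorEntry_mk v.1 v.2 i j).symm)

/-- The tangential coordinates as functions of the projective points. -/
def axialScore (gam : Fin q → Fin (m + 1) → Vec m) (y : Fin q → RP m) : Fin q × Fin m → ℝ :=
  fun i => ∑ j, ∑ k, gam i.1 i.2.castSucc j * gam i.1 (Fin.last m) k * projectorEntry (y i.1) j k

/-- Expressed through the lines, the scores inherit independence and identical distribution from
`Y`. -/
theorem tangentScore_eq_axialScore (gam : Fin q → Fin (m + 1) → Vec m) {x : Fin q → Vec m}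
    {y : Fin q → RP m} (h : ∀ s, IsUnitRep (x s) (y s)) :
    tangentScore gam x = axialScore gam y := by
  ext i
  rw [tangentScore, inner_mul_inner_eq_sum]
  simp only [(h i.1).mul_eq, axialScore]

theorem measurable_projectorEntry_apply (s : Fin q) (i j : Fin (m + 1)) :
    Measurable fun y : Fin q → RP m => projectorEntry (y s) i j :=
  (continuous_projectorEntry i j).measurable.comp (measurable_pi_apply s)

theorem measurable_axialScore (gam : Fin q → Fin (m + 1) → Vec m) :
    Measurable (axialScore (q := q) gam) := by
  refine measurable_pi_lambda _ fun i => ?_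
  simp only [axialScore]
  exact Finset.measurable_fun_sum _ fun j _ => Finset.measurable_fun_sum _ fun k _ =>
    (measurable_projectorEntry_apply i.1 j k).const_mul _

/-! ### Moments and limit theorems for the scores. -/

/-- The strong law of large numbers for functions of identically distributed variables. -/
theorem ae_tendsto_average {Ω S : Type*} [MeasurableSpace Ω] [MeasurableSpace S] {P : Measure Ω}
    {Q : Measure S} {Y : ℕ → Ω → S} (hlaw : ∀ r, HasLaw (Y r) Q P) (hindep : iIndepFun Y P)
    {f : S → ℝ} (hf : Measurable f) (hint : Integrable (fun ω => f (Y 0 ω)) P) :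
    ∀ᵐ ω ∂P, Tendsto (fun n : ℕ => (n : ℝ)⁻¹ * ∑ r ∈ Finset.range n, f (Y r ω)) atTop
      (𝓝 (∫ ω, f (Y 0 ω) ∂P)) := by
  have hid : ∀ r, IdentDistrib (Y r) (Y 0) P P := fun r =>
    ⟨(hlaw r).aemeasurable, (hlaw 0).aemeasurable, by rw [(hlaw r).map_eq, (hlaw 0).map_eq]⟩
  have := strong_law_ae_real (fun r ω => f (Y r ω)) hint
    (fun r r' hr => (hindep.indepFun hr).comp hf hf) fun r => (hid r).comp hf
  simpa only [div_eq_inv_mul] using this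

theorem dotProduct_momentMatrix_mulVec {Ω : Type*} [MeasurableSpace Ω] {P : Measure Ω}
    {Z : Ω → Vec m} (hZ : ∀ i j, Integrable (fun ω => Z ω i * Z ω j) P) (u w : Vec m) :
    u.ofLp ⬝ᵥ (momentMatrix P Z).mulVec w.ofLp = ∫ ω, inner ℝ u (Z ω) * inner ℝ w (Z ω) ∂P := by
  simp only [inner_mul_inner_eq_sum]
  rw [integral_finsetSum _ fun i _ => integrable_finsetSum _ fun j _ => (hZ i j).const_mul _]
  simp only [dotProduct, Matrix.mulVec, momentMatrix, Matrix.of_apply, Finset.mul_sum]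
  refine Finset.sum_congr rfl fun i _ => ?_
  rw [integral_finsetSum _ fun j _ => (hZ i j).const_mul _]
  refine Finset.sum_congr rfl fun j _ => ?_
  rw [integral_const_mul]
  ring

theorem dotProduct_secondMoments_mulVec {Ω ι : Type*} [Fintype ι] [MeasurableSpace Ω]
    {P : Measure Ω} {ζ : Ω → ι → ℝ} (hζ : ∀ i j, Integrable (fun ω => ζ ω i * ζ ω j) P)
    (x : ι → ℝ) :
    x ⬝ᵥ (Matrix.of fun i j => ∫ ω, ζ ω i * ζ ω j ∂P).mulVec x = ∫ ω, (x ⬝ᵥ ζ ω) ^ 2 ∂P := by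
  have : ∀ ω, (x ⬝ᵥ ζ ω) ^ 2 = ∑ i, ∑ j, x i * x j * (ζ ω i * ζ ω j) := fun ω => by
    simp only [sq, dotProduct, Finset.sum_mul_sum]
    exact Finset.sum_congr rfl fun i _ => Finset.sum_congr rfl fun j _ => by ring
  simp only [this]
  rw [integral_finsetSum _ fun i _ => integrable_finsetSum _ fun j _ => (hζ i j).const_mul _]
  simp only [dotProduct, Matrix.mulVec, Matrix.of_apply, Finset.mul_sum]
  refine Finset.sum_congr rfl fun i _ => ?_
  rw [integral_finsetSum _ fun j _ => (hζ i j).const_mul _]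
  refine Finset.sum_congr rfl fun j _ => ?_
  rw [integral_const_mul]
  ring

/-- A matrix of mixed second moments is positive semidefinite. -/
theorem posSemidef_secondMoments {Ω ι : Type*} [Fintype ι] [MeasurableSpace Ω] {P : Measure Ω}
    {ζ : Ω → ι → ℝ} (hζ : ∀ i j, Integrable (fun ω => ζ ω i * ζ ω j) P) :
    (Matrix.of fun i j => ∫ ω, ζ ω i * ζ ω j ∂P).PosSemidef := by
  refine Matrix.PosSemidef.of_dotProduct_mulVec_nonneg ?_ fun x => ?_
  · ext i j
    simp [mul_comm]
  · rw [star_trivial, dotProduct_secondMoments_mulVec hζ]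
    exact integral_nonneg fun ω => sq_nonneg _

/-- Standardized sums of whitened bounded centered vectors are asymptotically standard normal. -/
theorem tendstoInDistribution_whitened {Ω S ι : Type*} [Fintype ι] [DecidableEq ι]
    [MeasurableSpace Ω] [MeasurableSpace S] {P : Measure Ω} [IsProbabilityMeasure P]
    {Q : Measure S} {Y : ℕ → Ω → S} (hlaw : ∀ r, HasLaw (Y r) Q P) (hindep : iIndepFun Y P)
    {f : S → ι → ℝ} (hf : Measurable f) {c : ℝ} (hbound : ∀ ω i, |f (Y 0 ω) i| ≤ c)
    (hmean : ∀ i, ∫ ω, f (Y 0 ω) i ∂P = 0) {B : Matrix ι ι ℝ}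
    (hB : B * (Matrix.of fun i j => ∫ ω, f (Y 0 ω) i * f (Y 0 ω) j ∂P) * B.transpose = 1) :
    TendstoInDistribution (fun (n : ℕ) ω => WithLp.toLp 2
      ((√n)⁻¹ • ∑ r ∈ Finset.range n, B.mulVec (f (Y r ω)))) atTop
      (id : EuclideanSpace ℝ ι → _) (fun _ => P) (stdGaussian (EuclideanSpace ℝ ι)) := by
  have hid : ∀ r, IdentDistrib (Y r) (Y 0) P P := fun r =>
    ⟨(hlaw r).aemeasurable, (hlaw 0).aemeasurable, by rw [(hlaw r).map_eq, (hlaw 0).map_eq]⟩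
  have hm : AEMeasurable (fun ω => f (Y 0 ω)) P := hf.comp_aemeasurable (hlaw 0).aemeasurable
  have hmi : ∀ i, AEMeasurable (fun ω => f (Y 0 ω) i) P := fun i =>
    (measurable_pi_apply i).comp_aemeasurable hm
  have hL2 : ∀ i, MemLp (fun ω => f (Y 0 ω) i) 2 P := fun i =>
    MemLp.of_bound (hmi i).aestronglyMeasurable c (ae_of_all _ fun ω => hbound ω i)
  have hint : ∀ i j, Integrable (fun ω => f (Y 0 ω) i * f (Y 0 ω) j) P := fun i j =>
    (hL2 i).integrable_mul (hL2 j)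
  have hg : Measurable fun y => (WithLp.toLp 2 (B.mulVec (f y)) : EuclideanSpace ℝ ι) :=
    (WithLp.measurable_toLp 2 _).comp
      ((Continuous.matrix_mulVec continuous_const continuous_id).measurable.comp hf)
  have hinner : ∀ (t : EuclideanSpace ℝ ι) y, inner ℝ (WithLp.toLp 2 (B.mulVec (f y))) t =
      B.transpose.mulVec t.ofLp ⬝ᵥ f y := fun t y => by
    rw [Matrix.mulVec_transpose, ← Matrix.dotProduct_mulVec]
    simp [PiLp.inner_apply, dotProduct]
  have hM : ∀ t : EuclideanSpace ℝ ι,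
      MemLp (fun ω => inner ℝ (WithLp.toLp 2 (B.mulVec (f (Y 0 ω)))) t) 2 P := fun t => by
    simp only [hinner, dotProduct]
    exact memLp_finsetSum _ fun i _ => (hL2 i).const_mul _
  have hmean' : ∀ t : EuclideanSpace ℝ ι,
      ∫ ω, inner ℝ (WithLp.toLp 2 (B.mulVec (f (Y 0 ω)))) t ∂P = 0 := fun t => by
    simp only [hinner, dotProduct]
    rw [integral_finsetSum _ fun i _ => ((hL2 i).integrable one_le_two).const_mul _]
    simp [integral_const_mul, hmean]
  have h := tendstoInDistribution_stdGaussian (P := P)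
    (ξ := fun r ω => WithLp.toLp 2 (B.mulVec (f (Y r ω))))
    (hindep.comp (fun _ y => WithLp.toLp 2 (B.mulVec (f y))) fun _ => hg)
    (fun r => (hid r).comp hg) hM hmean' fun t => by
      rw [variance_of_integral_eq_zero (hM t).aestronglyMeasurable.aemeasurable (hmean' t)]
      simp only [hinner]
      rw [← dotProduct_secondMoments_mulVec hint, Matrix.mulVec_transpose,
        ← Matrix.dotProduct_mulVec, ← Matrix.mulVec_transpose, Matrix.mulVec_mulVec,
        Matrix.mulVec_mulVec, hB, Matrix.one_mulVec]
      rw [EuclideanSpace.norm_sq_eq]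
      simp [dotProduct, sq]
  convert! h using 3
  simp

theorem tangentCovariance_eq_secondMoments {Ω : Type*} [MeasurableSpace Ω] {P : Measure Ω}
    [IsProbabilityMeasure P] {Z : Ω → Fin q → Vec m} {gam : Fin q → Fin (m + 1) → Vec m}
    (hL2 : ∀ i, MemLp (fun ω => tangentScore gam (Z ω) i) 2 P)
    (hmean : ∀ i, ∫ ω, tangentScore gam (Z ω) i ∂P = 0) :
    tangentCovariance P Z gam =
      Matrix.of fun i j => ∫ ω, tangentScore gam (Z ω) i * tangentScore gam (Z ω) j ∂P := by
  ext i j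
  refine (covariance_eq_sub (hL2 i) (hL2 j)).trans ?_
  rw [hmean i, hmean j, mul_zero, sub_zero]
  rfl

/-- The mean is an off-diagonal entry of the moment matrix in its own eigenbasis. -/
theorem integral_tangentScore_eq_zero {Ω : Type*} [MeasurableSpace Ω] {P : Measure Ω}
    {Z : Ω → Fin q → Vec m} (hZ : ∀ s i j, Integrable (fun ω => Z ω s i * Z ω s j) P)
    {lam : Fin q → Fin (m + 1) → ℝ} {gam : Fin q → Fin (m + 1) → Vec m}
    (hpop : ∀ s, IsOrderedEigensystem (momentMatrix P fun ω => Z ω s) (lam s) (gam s))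
    (i : Fin q × Fin m) : ∫ ω, tangentScore gam (Z ω) i ∂P = 0 := by
  simp only [tangentScore]
  rw [← dotProduct_momentMatrix_mulVec (hZ i.1), (hpop i.1).dotProduct_mulVec_eigenvector,
    if_neg (Fin.castSucc_lt_last i.2).ne]

end AxialMean

end

/-! ### Assembly of the limit theorem. -/

open AxialMean in
theorem theorem4p1 {Ω : Type*} [MeasurableSpace Ω] (P : Measure Ω) [IsProbabilityMeasure P]
    (m q : ℕ)
    (Q : Measure (Fin q → AxialMean.RP m)) [IsProbabilityMeasure Q]
    -- an i.i.d. sample from `Q`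
    (Y : ℕ → Ω → Fin q → AxialMean.RP m)
    (hlaw : ∀ r, HasLaw (Y r) Q P) (hindep : iIndepFun Y P)
    -- its axial representation by unit vectors
    (X : ℕ → Ω → Fin q → AxialMean.Vec m)
    (hX : ∀ r ω s, AxialMean.IsUnitRep (X r ω s) (Y r ω s))
    -- population eigenvalues and eigenvectors, the largest eigenvalues positive and simple
    (lam : Fin q → Fin (m + 1) → ℝ) (gam : Fin q → Fin (m + 1) → AxialMean.Vec m)
    (hpop : ∀ s, AxialMean.IsOrderedEigensystem
      (AxialMean.momentMatrix P fun ω => X 0 ω s) (lam s) (gam s))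
    (hpos : ∀ s, 0 < lam s (Fin.last m))
    (hsimple : ∀ s a, lam s a = lam s (Fin.last m) → a = Fin.last m)
    -- nonsingular covariance on the tangent space
    (hcov : (AxialMean.tangentCovariance P (X 0) gam).det ≠ 0)
    -- sample eigenvalues and eigenvectors, for each sample size `n`
    (d : ℕ → Ω → Fin q → Fin (m + 1) → ℝ) (g : ℕ → Ω → Fin q → Fin (m + 1) → AxialMean.Vec m)
    (hsample : ∀ n ω s, AxialMean.IsOrderedEigensystem
      (AxialMean.sampleMomentMatrix n fun r => X r ω s) (d n ω s) (g n ω s))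
    (hmeas : ∀ n s a, AEMeasurable (fun ω => g n ω s a) P)
    -- the top sample eigenvectors are oriented consistently with the population ones
    (hsign : ∀ n ω s t, 0 ≤ inner ℝ (gam s (Fin.last m)) (g n ω s (Fin.last m))
      * inner ℝ (gam t (Fin.last m)) (g n ω t (Fin.last m))) :
    TendstoInDistribution
      (fun (n : ℕ) (ω : Ω) => AxialMean.hotellingT2 n (fun r => X r ω)
        (fun s => gam s (Fin.last m)) (d n ω) (g n ω))
      atTop (id : ℝ → ℝ) (fun _ => P) (AxialMean.chiSquare (m * q)) := by
  have hXE : ∀ r ω s i j, X r ω s i * X r ω s j = projectorEntry (Y r ω s) i j :=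
    fun r ω s i j => (hX r ω s).mul_eq i j
  have hZ : ∀ r ω, tangentScore gam (X r ω) = axialScore gam (Y r ω) := fun r ω =>
    tangentScore_eq_axialScore gam (hX r ω)
  have hXm : ∀ r s i j, AEMeasurable (fun ω => X r ω s i * X r ω s j) P := fun r s i j => by
    simp only [hXE]
    exact (measurable_projectorEntry_apply s i j).comp_aemeasurable (hlaw r).aemeasurable
  have hXi : ∀ s i j, Integrable (fun ω => X 0 ω s i * X 0 ω s j) P := fun s i j =>
    Integrable.of_bound (hXm 0 s i j).aestronglyMeasurable 1 (ae_of_all _ fun ω => by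
      have hc : ∀ i, ‖X 0 ω s i‖ ≤ 1 := fun i => (hX 0 ω s).1 ▸ PiLp.norm_apply_le (X 0 ω s) i
      rw [norm_mul]
      exact mul_le_one₀ (hc i) (norm_nonneg _) (hc j))
  have hbound : ∀ ω i, |axialScore gam (Y 0 ω) i| ≤ 1 := fun ω i => by
    rw [← hZ]
    exact abs_tangentScore_le (fun s => (hpop s).norm_eq_one) (fun s => (hX 0 ω s).1) i
  have hSm : ∀ i, Measurable fun y => axialScore (q := q) gam y i := fun i =>
    (measurable_pi_apply i).comp (measurable_axialScore gam)
  have hL2 : ∀ i, MemLp (fun ω => axialScore gam (Y 0 ω) i) 2 P := fun i =>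
    MemLp.of_bound ((hSm i).comp_aemeasurable (hlaw 0).aemeasurable).aestronglyMeasurable 1
      (ae_of_all _ fun ω => hbound ω i)
  have hmean : ∀ i, ∫ ω, axialScore gam (Y 0 ω) i ∂P = 0 := fun i => by
    simp only [← hZ]
    exact integral_tangentScore_eq_zero hXi hpop i
  have hint : ∀ i j, Integrable (fun ω => axialScore gam (Y 0 ω) i * axialScore gam (Y 0 ω) j) P :=
    fun i j => (hL2 i).integrable_mul (hL2 j)
  have hC : tangentCovariance P (X 0) gam = Matrix.of fun i j =>
      ∫ ω, axialScore gam (Y 0 ω) i * axialScore gam (Y 0 ω) j ∂P := by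
    simp only [← hZ] at hL2 hmean ⊢
    exact tangentCovariance_eq_secondMoments hL2 hmean
  rw [hC] at hcov
  obtain ⟨B, hB⟩ := exists_whitening (posSemidef_secondMoments hint) hcov
  have hclt := tendstoInDistribution_whitened hlaw hindep (measurable_axialScore gam) hbound hmean hB
  have hd : ∀ n s a, AEMeasurable (fun ω => d n ω s a) P := fun n s a =>
    aemeasurable_eigenvalue (Z := fun r ω => X r ω s) (d := fun ω => d n ω s)
      (fun r => hXm r s) (fun ω => hsample n ω s) (hmeas n s) a
  -- The studentizing matrix in whitened population coordinates; by `hB` its almost sure limit is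
  -- the identity.
  set W : ℕ → Ω → Matrix (Fin q × Fin m) (Fin q × Fin m) ℝ := fun n ω =>
    B * (alignMatrix gam (d n ω) (g n ω) * studentMatrix n (fun r => X r ω) (d n ω) (g n ω)
      * (alignMatrix gam (d n ω) (g n ω)).transpose) * B.transpose with hW
  have hWm : ∀ n i j, AEMeasurable (fun ω => W n ω i j) P := fun n => by
    have ha := aemeasurable_alignMatrix (P := P) gam (hd n) (hmeas n)
    exact aemeasurable_matrix_mul (aemeasurable_matrix_mul (fun _ _ => aemeasurable_const)
      (aemeasurable_matrix_mul (aemeasurable_matrix_mul ha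
        (aemeasurable_studentMatrix hXm (hd n) (hmeas n))) fun i j => ha j i))
      fun _ _ => aemeasurable_const
  have hJ : ∀ᵐ ω ∂P, ∀ s i j, Tendsto (fun n => sampleMomentMatrix n (fun r => X r ω s) i j) atTop
      (𝓝 (momentMatrix P (fun ω => X 0 ω s) i j)) := by
    refine ae_all_iff.2 fun s => ae_all_iff.2 fun i => ae_all_iff.2 fun j => ?_
    have hi := hXi s i j
    simp only [hXE] at hi
    filter_upwards [ae_tendsto_average hlaw hindep (f := fun y => projectorEntry (y s) i j)
      (measurable_projectorEntry_apply s i j) hi] with ω hω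
    simpa only [sampleMomentMatrix, momentMatrix, Matrix.of_apply, Matrix.smul_apply,
      Matrix.sum_apply, Matrix.vecMulVec_apply, smul_eq_mul, hXE] using hω
  have hS : ∀ᵐ ω ∂P, ∀ i j, Tendsto (fun n : ℕ => (n : ℝ)⁻¹ * ∑ r ∈ Finset.range n,
      tangentScore gam (X r ω) i * tangentScore gam (X r ω) j) atTop
      (𝓝 (∫ ω, axialScore gam (Y 0 ω) i * axialScore gam (Y 0 ω) j ∂P)) := by
    refine ae_all_iff.2 fun i => ae_all_iff.2 fun j => ?_
    simp only [hZ]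
    exact ae_tendsto_average hlaw hindep
      (f := fun y => axialScore gam y i * axialScore gam y j) ((hSm i).mul (hSm j)) (hint i j)
  have hWlim : ∀ᵐ ω ∂P, Tendsto (fun n => W n ω) atTop (𝓝 1) := by
    filter_upwards [hJ, hS] with ω hJω hSω
    have h := tendsto_alignMatrix_mul_studentMatrix (fun r s => (hX r ω s).1) hpop hsimple
      (fun n => hsample n ω) (fun n => hsign n ω) hJω (C := Matrix.of fun i j =>
        ∫ ω, axialScore gam (Y 0 ω) i * axialScore gam (Y 0 ω) j ∂P) hSω
    rw [← hB]
    exact ((continuous_const.matrix_mul continuous_id).matrix_mul continuous_const).tendsto _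
      |>.comp h
  refine tendstoInDistribution_chiSquare (N := fun n ω => (W n ω)⁻¹) (by simp [mul_comm]) hclt
    (fun n => aemeasurable_matrix_inv (hWm n))
    (hWlim.mono fun ω hω => (tendsto_matrix_inv_one hω).1)
    (fun n => aemeasurable_hotellingT2 hXm _ (hd n) (hmeas n)) (hWlim.mono fun ω hω => ?_)
  -- Almost surely `W n ω` is invertible for all large `n`, which is what the exact formula
  -- requires.
  filter_upwards [(tendsto_matrix_inv_one hω).2] with n hn
  rw [hotellingT2_eq (fun s => (hpop s).orthonormal) (hsample n ω) B hn]
  simp only [hZ]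
  rfl
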